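/- Let $p > 7200$ be a prime, let $V$ be a finite vector space over a field of characteristic $p$, and suppose that $|V| \ge p^3$. Let $H \le \mathrm{GL}(V)$ be a (finite) solvable subgroup whose order is not divisible by $p$, and let $HV = V \rtimes H$ be the semidirect product of the additive group of $V$ with $H$ acting naturally on it. Then $k(HV) > p$, where $k(X)$ denotes the number of conjugacy classes of a finite group $X$. -/

import Mathlib

/-- The natural action of a subgroup `H` of `GL(V)` on the additive group of `V`, written
multiplicatively. -/
def linearActionHom {K V : Type*} [Field K] [AddCommGroup V] [Module K V]
    (H : Subgroup (LinearMap.GeneralLinearGroup K V)) : H →* MulAut (Multiplicative V) :=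
  (MulAutMultiplicative V).symm.toMonoidHom.comp (DistribMulAction.toAddAut H V)

theorem linearActionHom_apply {K V : Type*} [Field K] [AddCommGroup V] [Module K V]
    (H : Subgroup (LinearMap.GeneralLinearGroup K V)) (h : H) (v : V) :
    linearActionHom H h (Multiplicative.ofAdd v) =
      Multiplicative.ofAdd (((h : LinearMap.GeneralLinearGroup K V) : V →ₗ[K] V) v) :=
  rfl

/-- The affine group `HV`: the semidirect product of the additive group of `V` with the linear
group `H ≤ GL(V)` acting naturally on it. -/
abbrev AffineSemidirect {K V : Type*} [Field K] [AddCommGroup V] [Module K V]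
    (H : Subgroup (LinearMap.GeneralLinearGroup K V)) : Type _ :=
  Multiplicative V ⋊[linearActionHom H] H

/-- The class number `k(G)`: the number of conjugacy classes of `G`. -/
noncomputable def classNumber (G : Type*) [Group G] : ℕ :=
  Nat.card (ConjClasses G)

/-! Let `d ≥ 3` be the dimension of `V` over the prime field. Counting commuting pairs in a finite
group `X` gives `|B|^2 ≤ |X| k(X)` for every abelian subgroup `B`. With `B = V` in `HV`, this yields
`|V| ≤ |H| k(HV)`. Since `k(H) ≤ k(HV)`, it also yields `|A|^2 ≤ |H| k(HV)` for every abelian `A ≤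
H`. If `|H| ≤ |A| m` and `k(HV) ≤ p`, multiplying the two bounds cancels `|A|` and leaves `p^(d-2) ≤
m^2`. So an abelian `A` of index below `84^(d-2)` suffices, because `84^2 = 7056 < p`. If `A`
consists of scalars, then `|A| ≤ p`, and the first bound alone allows `m` up to `7056^(d-2)`.

To find `A`, take a maximal abelian normal subgroup and a maximal normal `F ≥ A` that centralizes
`A` and is abelian modulo `A` (`exists_abelian_normal_and_class_two`). Over the algebraic closure
the space splits into weight spaces of `A`, of dimensions `e_i`. The group permutes the `n` weights
with kernel inside `C(A)`, and solvable permutation groups have order at most `3^(n-1)`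
(`index_ker_le_three_pow`). On each weight space `F` acts by operators commuting up to scalars, so
modulo the centrally acting elements it has order at most `e_i^2` (`index_operatorCenter_le`), and
`C(A)/F` is controlled by automorphisms of these quotients (`card_centralizer_le`). The numerical
core is `mul_prod_weightBound_lt`. -/

/-! ### Orders of automorphism groups -/

/-- An upper bound for the order of the automorphism group of a group of order `b`. -/
def autBound (b : ℕ) : ℕ :=
  ∏ i ∈ Finset.range (Nat.log 2 b), (b - 2 ^ i)

theorem one_le_sub_two_pow {b i : ℕ} (hi : i < Nat.log 2 b) : 1 ≤ b - 2 ^ i := by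
  have hb : b ≠ 0 := by rintro rfl; simp at hi
  have h1 : 2 ^ i < 2 ^ Nat.log 2 b := Nat.pow_lt_pow_right (by norm_num) hi
  have h2 := Nat.pow_log_le_self 2 hb
  omega

theorem autBound_mono {a b : ℕ} (h : a ≤ b) : autBound a ≤ autBound b := by
  unfold autBound
  calc ∏ i ∈ Finset.range (Nat.log 2 a), (a - 2 ^ i)
      ≤ ∏ i ∈ Finset.range (Nat.log 2 a), (b - 2 ^ i) :=
        Finset.prod_le_prod' fun i _ => Nat.sub_le_sub_right h _
    _ ≤ ∏ i ∈ Finset.range (Nat.log 2 b), (b - 2 ^ i) :=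
        Finset.prod_le_prod_of_subset_of_one_le'
          (Finset.range_subset_range.2 (Nat.log_mono_right h))
          fun i hi _ => one_le_sub_two_pow (Finset.mem_range.1 hi)

theorem autBound_le (b : ℕ) : autBound b ≤ b ^ Nat.log 2 b := by
  unfold autBound
  calc _ ≤ ∏ _i ∈ Finset.range (Nat.log 2 b), b := Finset.prod_le_prod' fun i _ => Nat.sub_le _ _
    _ = _ := by simp

/-- If a group of automorphisms fixes `D` pointwise, its order is bounded by choosing images of
further generators one at a time. -/
theorem card_fixing_le {B : Type*} [Group B] [Finite B] (k : ℕ) :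
    ∀ (D : Subgroup B) (Γ : Subgroup (MulAut B)), Nat.card B - Nat.card D ≤ k →
      (∀ γ ∈ Γ, ∀ x ∈ D, γ x = x) →
      Nat.card Γ ≤ ∏ i ∈ Finset.Ico (Nat.log 2 (Nat.card D)) (Nat.log 2 (Nat.card B)),
        (Nat.card B - 2 ^ i) := by
  have : Finite (MulAut B) := Finite.of_injective (fun γ : MulAut B => (γ : B → B))
    DFunLike.coe_injective
  induction k with
  | zero =>
    intro D Γ hk hfix
    have hD : D = ⊤ := Subgroup.eq_top_of_le_card D (by omega)
    have hΓ : Γ = ⊥ := by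
      rw [Subgroup.eq_bot_iff_forall]
      intro γ hγ
      ext x
      exact hfix γ hγ x (hD ▸ Subgroup.mem_top x)
    subst hD hΓ
    simp
  | succ k ih =>
    intro D Γ hk hfix
    by_cases hD : D = ⊤
    · exact ih D Γ (by subst hD; simp) hfix
    obtain ⟨g, hg⟩ : ∃ g, g ∉ D := by
      by_contra! h
      exact hD (Subgroup.eq_top_iff' D |>.2 h)
    set D' := D ⊔ Subgroup.zpowers g with hD'
    have hgD' : g ∈ D' := Subgroup.mem_sup_right (Subgroup.mem_zpowers g)
    have hlt : D < D' := lt_of_le_of_ne le_sup_left fun h => hg (h ▸ hgD')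
    have hcard : 2 * Nat.card D ≤ Nat.card D' := by
      obtain ⟨c, hc⟩ := Subgroup.card_dvd_of_le hlt.le
      have h1 : Nat.card D < Nat.card D' := by
        by_contra! h
        exact hlt.ne (Subgroup.eq_of_le_of_card_ge hlt.le h)
      rw [hc] at h1 ⊢
      have : 2 ≤ c := by
        by_contra! hc2
        interval_cases c <;> omega
      nlinarith
    have hDpos : 0 < Nat.card D := Nat.card_pos
    have hlog : Nat.log 2 (Nat.card D) + 1 ≤ Nat.log 2 (Nat.card D') := by
      rw [← Nat.log_mul_base (by norm_num) hDpos.ne']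
      exact Nat.log_mono_right (by omega)
    have hD'B : Nat.card D' ≤ Nat.card B := Subgroup.card_le_card_group D'
    have hlog' : Nat.log 2 (Nat.card D') ≤ Nat.log 2 (Nat.card B) := Nat.log_mono_right hD'B
    let Γ' : Subgroup (MulAut B) := Γ ⊓ MulAction.stabilizer (MulAut B) g
    have hfix' : ∀ γ ∈ Γ', ∀ x ∈ D', γ x = x := by
      intro γ hγ x hx
      have : D' ≤ γ.toMonoidHom.eqLocus (MonoidHom.id B) := by
        refine sup_le (fun y hy => hfix γ hγ.1 y hy) ?_
        rw [Subgroup.zpowers_le]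
        exact hγ.2
      exact this hx
    have h1 := ih D' Γ' (by omega) hfix'
    have h2 : Nat.card Γ ≤ (Nat.card B - Nat.card D) * Nat.card Γ' := by
      have e1 : Nat.card (MulAction.orbit Γ g) * Nat.card (MulAction.stabilizer Γ g)
          = Nat.card Γ := by
        rw [← Nat.card_prod]
        exact Nat.card_congr (MulAction.orbitProdStabilizerEquivGroup Γ g)
      have e2 : Nat.card (MulAction.stabilizer Γ g) = Nat.card Γ' := by
        refine Nat.card_congr
          { toFun := fun x => ⟨x.1.1, x.1.2, x.2⟩
            invFun := fun x => ⟨⟨x.1, x.2.1⟩, x.2.2⟩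
            left_inv := fun x => rfl
            right_inv := fun x => rfl }
      -- If `γ g` were in `D`, then `γ` would fix it, and injectivity would give `γ g = g`, which is
      -- outside `D`.
      have e3 : Nat.card (MulAction.orbit Γ g) ≤ Nat.card B - Nat.card D := by
        have hsub : MulAction.orbit Γ g ⊆ (D : Set B)ᶜ := by
          rintro _ ⟨γ, rfl⟩ hmem
          have hmem' : γ.1 g ∈ D := hmem
          have : γ.1 (γ.1 g) = γ.1 g := hfix γ.1 γ.2 _ hmem'
          exact hg (γ.1.injective this ▸ hmem')
        calc Nat.card (MulAction.orbit Γ g) ≤ Nat.card ((D : Set B)ᶜ : Set B) :=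
              Nat.card_mono (Set.toFinite _) hsub
          _ = _ := by
              rw [Nat.card_coe_set_eq, Set.ncard_compl]; rfl
      rw [← e1, e2]
      exact Nat.mul_le_mul_right _ e3
    calc Nat.card Γ ≤ (Nat.card B - Nat.card D) * Nat.card Γ' := h2
      _ ≤ (Nat.card B - 2 ^ Nat.log 2 (Nat.card D)) *
          ∏ i ∈ Finset.Ico (Nat.log 2 (Nat.card D) + 1) (Nat.log 2 (Nat.card B)),
            (Nat.card B - 2 ^ i) := by
          refine Nat.mul_le_mul (Nat.sub_le_sub_left (Nat.pow_log_le_self 2 hDpos.ne') _)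
            (h1.trans ?_)
          -- Adjoining `g` may raise the logarithm by more than one; the skipped factors are at
          -- least 1.
          refine Finset.prod_le_prod_of_subset_of_one_le'
            (Finset.Ico_subset_Ico_left hlog) fun i hi _ => ?_
          exact one_le_sub_two_pow (Finset.mem_Ico.1 hi).2
      _ = _ := by
          rw [← Finset.prod_eq_prod_Ico_succ_bot (by omega) fun i => Nat.card B - 2 ^ i]

theorem card_mulAut_le (B : Type*) [Group B] [Finite B] :
    Nat.card (MulAut B) ≤ autBound (Nat.card B) := by
  have := card_fixing_le (B := B) _ ⊥ ⊤ le_rfl (by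
    intro γ _ x hx
    rw [Subgroup.mem_bot.1 hx, map_one])
  simpa [autBound] using this

/-! ### Solvable permutation groups -/

/-- A normal subgroup of a finite solvable group that is not contained in a normal subgroup `A`
contains a normal subgroup with the same property that is abelian modulo `A`. -/
theorem exists_normal_commutator_le {G : Type*} [Group G] [Finite G] [Group.IsSolvable G]
    (A : Subgroup G) (N : Subgroup G) [N.Normal] (hN : ¬ N ≤ A) :
    ∃ E : Subgroup G, E.Normal ∧ E ≤ N ∧ ¬ E ≤ A ∧ ⁅E, E⁆ ≤ A := by
  induction hn : Nat.card N using Nat.strong_induction_on generalizing N with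
  | _ n ih =>
    by_cases h : ⁅N, N⁆ ≤ A
    · exact ⟨N, inferInstance, le_rfl, hN, h⟩
    · have hne : N ≠ ⊥ := by
        rintro rfl
        exact hN bot_le
      have hlt := Group.IsSolvable.commutator_lt_of_ne_bot hne
      have hc : Nat.card (⁅N, N⁆ : Subgroup G) < n := by
        rw [← hn]
        by_contra! hle
        exact hlt.ne (Subgroup.eq_of_le_of_card_ge hlt.le hle)
      obtain ⟨E, h1, h2, h3, h4⟩ := ih _ hc ⁅N, N⁆ h rfl
      exact ⟨E, h1, h2.trans hlt.le, h3, h4⟩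

/-- A faithful permutation group with a transitive abelian normal subgroup `N` has order at most
`n * |Aut N|`, where `n = |N|` is the degree. -/
theorem card_le_of_transitive_normal {G X : Type*} [Group G] [Finite G] [MulAction G X]
    [FaithfulSMul G X] [Finite X] (N : Subgroup G) [N.Normal] (hN : ∀ a ∈ N, ∀ b ∈ N, a * b = b * a)
    (x₀ : X) (htrans : ∀ x : X, ∃ g ∈ N, g • x₀ = x) :
    Nat.card G ≤ Nat.card X * autBound (Nat.card X) := by
  -- A transitive faithful abelian group is regular. Hence a point stabilizer acts faithfully on `N`
  -- by conjugation.
  have hfree : ∀ g ∈ N, g • x₀ = x₀ → g = 1 := by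
    intro g hg h
    refine FaithfulSMul.eq_of_smul_eq_smul (α := X) fun x => ?_
    obtain ⟨n, hn, rfl⟩ := htrans x
    rw [← mul_smul, hN g hg n hn, mul_smul, h, one_smul]
  have hcard : Nat.card N = Nat.card X := by
    refine Nat.card_congr (Equiv.ofBijective (fun n : N => n.1 • x₀) ⟨?_, ?_⟩)
    · intro a b hab
      have hab' : a.1 • x₀ = b.1 • x₀ := hab
      have := hfree (b.1⁻¹ * a.1) (N.mul_mem (N.inv_mem b.2) a.2) (by
        rw [mul_smul, hab', inv_smul_smul])
      exact Subtype.ext (inv_mul_eq_one.1 this).symm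
    · intro x
      obtain ⟨g, hg, h⟩ := htrans x
      exact ⟨⟨g, hg⟩, h⟩
  let S := MulAction.stabilizer G x₀
  let f : S →* MulAut N := MulAut.conjNormal.comp S.subtype
  have hf : Function.Injective f := by
    rw [injective_iff_map_eq_one]
    intro s hs
    ext
    refine FaithfulSMul.eq_of_smul_eq_smul (α := X) fun x => ?_
    obtain ⟨n, hn, rfl⟩ := htrans x
    have h1 : s.1 * n * s.1⁻¹ = n := by
      have := congrArg (fun φ : MulAut N => ((φ ⟨n, hn⟩ : N) : G)) hs
      simpa [f] using this
    have h2 : s.1 • x₀ = x₀ := s.2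
    have h3 : s.1 * n = n * s.1 := by rwa [mul_inv_eq_iff_eq_mul] at h1
    simp only [OneMemClass.coe_one, one_smul]
    rw [← mul_smul, h3, mul_smul, h2]
  have : Finite (MulAut N) := Finite.of_injective (fun γ : MulAut N => (γ : N → N))
    DFunLike.coe_injective
  have hS : Nat.card S ≤ autBound (Nat.card X) :=
    (Nat.card_le_card_of_injective f hf).trans (hcard ▸ card_mulAut_le N)
  have h1 : Nat.card (MulAction.orbit G x₀) * Nat.card S = Nat.card G := by
    rw [← Nat.card_prod]
    exact Nat.card_congr (MulAction.orbitProdStabilizerEquivGroup G x₀)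
  rw [← h1]
  exact Nat.mul_le_mul (Nat.card_le_card_of_injective _ Subtype.val_injective) hS

/-- The kernel of the action on blocks preserves every fibre, and an element trivial on all fibres
is trivial on `X`. -/
theorem index_ker_le_of_fibers {G X Y : Type*} [Group G] [Finite G] [Finite X] [Fintype Y]
    (φ : G →* Equiv.Perm X) (f : X → Y) (hf : Function.Surjective f) (ψ : G →* Equiv.Perm Y)
    (hψ : ∀ g x, f (φ g x) = ψ g (f x)) (b : Y → ℕ)
    (hb : ∀ (y : Y) (χ : ψ.ker →* Equiv.Perm {x // f x = y}), χ.ker.index ≤ b y) :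
    φ.ker.index ≤ ψ.ker.index * ∏ y, b y := by
  have hle : φ.ker ≤ ψ.ker := by
    intro g hg
    rw [MonoidHom.mem_ker] at hg ⊢
    ext y
    obtain ⟨x, rfl⟩ := hf y
    rw [← hψ, hg]
    rfl
  have hfib : ∀ (y : Y) (k : ψ.ker) (x : X), f (φ k x) = y ↔ f x = y := by
    intro y k x
    rw [hψ, (MonoidHom.mem_ker).1 k.2]
    rfl
  let χ : ∀ y, ψ.ker →* Equiv.Perm {x // f x = y} := fun y =>
    { toFun := fun k => (φ k).subtypePerm (hfib y k)
      map_one' := by ext x; simp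
      map_mul' := fun a c => by ext x; simp; rfl }
  have hinf : φ.ker.subgroupOf ψ.ker = ⨅ y, (χ y).ker := by
    ext k
    simp only [Subgroup.mem_subgroupOf, Subgroup.mem_iInf, MonoidHom.mem_ker]
    constructor
    · intro h y
      ext x
      simp [χ, h]
    · intro h
      ext x
      have := congrArg (fun σ => (σ ⟨x, rfl⟩ : {x' // f x' = f x}).1) (h (f x))
      simpa [χ] using this
  have h1 := Subgroup.relIndex_mul_index hle
  rw [← h1, mul_comm]
  refine Nat.mul_le_mul_left _ ?_
  rw [Subgroup.relIndex, hinf]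
  exact (Subgroup.index_iInf_le _).trans (Finset.prod_le_prod' fun y _ => hb y (χ y))

/-- The exponent "degree minus one" is additive along a block system, which is what makes the bound
`3 ^ (n - 1)` inductive. -/
theorem prod_three_pow_fibers {X Y : Type*} [Finite X] [Fintype Y] (f : X → Y)
    (hf : Function.Surjective f) :
    ∏ y, 3 ^ (Nat.card {x // f x = y} - 1) = 3 ^ (Nat.card X - Nat.card Y) := by
  have h1 : ∑ y, Nat.card {x // f x = y} = Nat.card X := by
    rw [← Nat.card_sigma]
    exact Nat.card_congr (Equiv.sigmaFiberEquiv f)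
  have h2 : ∀ y, Nat.card {x // f x = y} - 1 + 1 = Nat.card {x // f x = y} := by
    intro y
    obtain ⟨x, hx⟩ := hf y
    have : Nonempty {x // f x = y} := ⟨⟨x, hx⟩⟩
    exact Nat.sub_add_cancel Nat.card_pos
  rw [Finset.prod_pow_eq_pow_sum]
  congr 1
  have h3 : ∑ y, (Nat.card {x // f x = y} - 1) + Nat.card Y = Nat.card X := by
    rw [← h1, Nat.card_eq_fintype_card, Fintype.card_eq_sum_ones, ← Finset.sum_add_distrib]
    exact Finset.sum_congr rfl fun y _ => h2 y
  omega

theorem mul_autBound_le_three_pow (n : ℕ) (hn : n ≠ 0) : n * autBound n ≤ 3 ^ (n - 1) := by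
  by_cases h : n < 64
  · unfold autBound
    have : ∀ n < 64, n ≠ 0 →
        n * ∏ i ∈ Finset.range (Nat.log 2 n), (n - 2 ^ i) ≤ 3 ^ (n - 1) := by decide +kernel
    exact this n h hn
  · set t := Nat.log 2 n with ht
    -- The cutoff 64 is where `(t + 1)^2 + 1 ≤ 2^t` starts to hold; it fails at `t = 5`.
    have ht6 : 6 ≤ t := (Nat.le_log_iff_pow_le (by norm_num) hn).2 (by omega)
    have h1 : 2 ^ t ≤ n := Nat.pow_log_le_self 2 hn
    have h2 : n < 2 ^ (t + 1) := Nat.lt_pow_succ_log_self (by norm_num) n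
    have h3 : ∀ s, 6 ≤ s → (s + 1) * (s + 1) + 1 ≤ 2 ^ s := by
      intro s hs
      induction s, hs using Nat.le_induction with
      | base => norm_num
      | succ s hs ih => rw [pow_succ]; nlinarith
    calc n * autBound n ≤ n * n ^ t := Nat.mul_le_mul_left _ (autBound_le n)
      _ = n ^ (t + 1) := by ring
      _ ≤ (2 ^ (t + 1)) ^ (t + 1) := Nat.pow_le_pow_left h2.le _
      _ = 2 ^ ((t + 1) * (t + 1)) := by rw [← pow_mul]
      _ ≤ 2 ^ (n - 1) := Nat.pow_le_pow_right (by norm_num) (by have := h3 t ht6; omega)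
      _ ≤ 3 ^ (n - 1) := Nat.pow_le_pow_left (by norm_num) _

/-- The action on the quotient by an invariant equivalence relation. -/
def quotientPermHom {G X : Type*} [Group G] (φ : G →* Equiv.Perm X) (r : Setoid X)
    (hr : ∀ g x y, r x y → r (φ g x) (φ g y)) : G →* Equiv.Perm (Quotient r) where
  toFun g := Quotient.congr (φ g) fun x y => ⟨hr g x y, fun h => by
    have := hr g⁻¹ _ _ h
    simpa using this⟩
  map_one' := by
    ext x
    induction x using Quotient.inductionOn
    simp
  map_mul' a b := by
    ext x
    induction x using Quotient.inductionOn
    simp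

/-- The orbits of a nontrivial abelian normal subgroup form an invariant partition that is not
discrete. By primitivity the subgroup is transitive. -/
theorem card_le_of_primitive {X : Type*} [Finite X] (P : Subgroup (Equiv.Perm X))
    [Group.IsSolvable P] (hX : Nat.card X ≠ 0)
    (hprim : ∀ r : Setoid X, (∀ g ∈ P, ∀ x y, r x y → r (g x) (g y)) → r = ⊥ ∨ r = ⊤) :
    Nat.card P ≤ 3 ^ (Nat.card X - 1) := by
  by_cases hP : (⊤ : Subgroup P) ≤ ⊥
  · have : Nat.card P = 1 := by
      rw [← Subgroup.card_top, le_bot_iff.1 hP, Subgroup.card_bot]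
    rw [this]
    exact Nat.one_le_pow _ _ (by norm_num)
  obtain ⟨N, hNn, -, hN, hcomm⟩ := exists_normal_commutator_le (G := P) ⊥ ⊤ hP
  let r : Setoid X := MulAction.orbitRel N X
  have hr : ∀ g ∈ P, ∀ x y, r x y → r (g x) (g y) := by
    rintro g hg x y ⟨n, rfl⟩
    refine ⟨⟨⟨g, hg⟩ * n.1 * ⟨g, hg⟩⁻¹, hNn.conj_mem _ n.2 _⟩, ?_⟩
    change (g * (n.1.1 : Equiv.Perm X) * g⁻¹) (g y) = g ((n.1.1 : Equiv.Perm X) y)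
    simp
  have htop : r = ⊤ := by
    refine (hprim r hr).resolve_left fun hbot => hN ?_
    intro n hn
    rw [Subgroup.mem_bot]
    ext x
    have h : r (n.1 x) x := ⟨⟨n, hn⟩, rfl⟩
    rw [hbot] at h
    exact h
  have : Nonempty X := by
    by_contra h
    rw [not_nonempty_iff] at h
    exact hX Nat.card_of_isEmpty
  obtain ⟨x₀⟩ := this
  refine (card_le_of_transitive_normal N ?_ x₀ ?_).trans (mul_autBound_le_three_pow _ hX)
  · intro a ha b hb
    have h1 := hcomm (Subgroup.commutator_mem_commutator ha hb)
    exact commutatorElement_eq_one_iff_mul_comm.1 (Subgroup.mem_bot.1 h1)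
  · intro x
    have h : r x x₀ := by rw [htop]; trivial
    obtain ⟨n, hn⟩ := h
    exact ⟨n.1, n.2, hn⟩

/-- A solvable permutation group of degree `n` has order at most `3 ^ (n - 1)`. -/
theorem index_ker_le_three_pow {G X : Type*} [Group G] [Finite G] [Group.IsSolvable G] [Finite X]
    (φ : G →* Equiv.Perm X) : φ.ker.index ≤ 3 ^ (Nat.card X - 1) := by
  induction hn : Nat.card X using Nat.strong_induction_on generalizing G X with
  | _ n ih =>
    subst hn
    by_cases h0 : Nat.card X = 0
    · have : IsEmpty X := by
        rcases Nat.card_eq_zero.1 h0 with h | h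
        · exact h
        · exact absurd h (not_infinite_iff_finite.2 inferInstance)
      have : φ.ker = ⊤ := by
        rw [Subgroup.eq_top_iff']
        intro g
        exact Subsingleton.elim _ _
      simp [this]
    by_cases hr : ∀ r : Setoid X, (∀ g ∈ φ.range, ∀ x y, r x y → r (g x) (g y)) → r = ⊥ ∨ r = ⊤
    · rw [Subgroup.index_ker]
      have : Group.IsSolvable φ.range :=
        Group.isSolvable_of_surjective φ.rangeRestrict_surjective
      exact card_le_of_primitive φ.range h0 hr
    · push Not at hr
      obtain ⟨r, hr, hbot, htop⟩ := hr
      have hr' : ∀ g x y, r x y → r (φ g x) (φ g y) := fun g x y h => hr _ ⟨g, rfl⟩ x y h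
      classical
      have : Fintype (Quotient r) := Fintype.ofFinite _
      have hsurj : Function.Surjective (Quotient.mk r) := Quotient.mk_surjective
      have hlt : Nat.card (Quotient r) < Nat.card X := by
        refine lt_of_le_of_ne (Nat.card_le_card_of_surjective _ hsurj) fun h => hbot ?_
        have hinj := (Function.Surjective.bijective_of_nat_card_le hsurj h.ge).1
        rw [eq_bot_iff]
        intro x y hxy
        exact hinj (Quotient.sound hxy)
      have hpos : 0 < Nat.card (Quotient r) := by
        have : Nonempty X := (Nat.card_ne_zero.1 h0).1
        have : Nonempty (Quotient r) := this.map (Quotient.mk r)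
        exact Nat.card_pos
      have hfib : ∀ y, Nat.card {x // Quotient.mk r x = y} < Nat.card X := by
        intro y
        obtain ⟨x, hx⟩ : ∃ x, Quotient.mk r x ≠ y := by
          by_contra! hy
          refine htop ?_
          rw [eq_top_iff]
          intro a b _
          exact Quotient.exact ((hy a).trans (hy b).symm)
        exact Finite.card_subtype_lt hx
      have key := index_ker_le_of_fibers φ (Quotient.mk r) hsurj (quotientPermHom φ r hr')
        (fun g x => rfl) (fun y => 3 ^ (Nat.card {x // Quotient.mk r x = y} - 1))
        (fun y χ => ih _ (hfib y) χ rfl)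
      rw [prod_three_pow_fibers _ hsurj] at key
      refine key.trans ?_
      calc _ ≤ 3 ^ (Nat.card (Quotient r) - 1) * 3 ^ (Nat.card X - Nat.card (Quotient r)) :=
            Nat.mul_le_mul_right _ (ih _ hlt (quotientPermHom φ r hr') rfl)
        _ = 3 ^ (Nat.card X - 1) := by
            rw [← pow_add]
            congr 1
            omega

/-- Each level set of `e` is invariant and saves one factor 3, and there are at least two of them.
-/
theorem index_ker_le_three_pow_of_ne {G X : Type*} [Group G] [Finite G] [Group.IsSolvable G]
    [Finite X] (φ : G →* Equiv.Perm X) (e : X → ℕ) (he : ∀ g x, e (φ g x) = e x)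
    (hne : ∃ x y, e x ≠ e y) : φ.ker.index ≤ 3 ^ (Nat.card X - 2) := by
  classical
  have : Fintype (Set.range e) := Fintype.ofFinite _
  have key := index_ker_le_of_fibers φ (Set.rangeFactorization e) Set.rangeFactorization_surjective
    1 (fun g x => Subtype.ext (he g x)) _ (fun y χ => index_ker_le_three_pow χ)
  rw [prod_three_pow_fibers _ Set.rangeFactorization_surjective] at key
  refine key.trans ?_
  have h2 : 2 ≤ Nat.card (Set.range e) := by
    obtain ⟨x, y, h⟩ := hne
    have : Nontrivial (Set.range e) :=
      ⟨⟨e x, x, rfl⟩, ⟨e y, y, rfl⟩, fun h' => h (congrArg Subtype.val h')⟩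
    exact Finite.one_lt_card
  have h1 : (1 : G →* Equiv.Perm (Set.range e)).ker.index = 1 := by
    rw [MonoidHom.ker_one, Subgroup.index_top]
  rw [h1, one_mul]
  exact Nat.pow_le_pow_right (by norm_num) (by omega)

/-! ### A maximal abelian normal subgroup and a class-two group above it -/

theorem commutator_le_iff_map_le_centralizer {G : Type*} [Group G] (A : Subgroup G) [A.Normal]
    (H K : Subgroup G) :
    ⁅H, K⁆ ≤ A ↔ H ≤ (Subgroup.centralizer (K.map (QuotientGroup.mk' A) : Set (G ⧸ A))).comap
      (QuotientGroup.mk' A) := by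
  rw [Subgroup.commutator_le]
  refine forall₂_congr fun h _ => ?_
  rw [Subgroup.mem_comap, Subgroup.mem_centralizer_iff]
  simp only [Subgroup.coe_map, Set.forall_mem_image, SetLike.mem_coe]
  refine forall₂_congr fun k _ => ?_
  rw [← QuotientGroup.eq_one_iff, ← QuotientGroup.mk'_apply, map_commutatorElement,
    commutatorElement_eq_one_iff_mul_comm, eq_comm]

theorem sup_commutator_le {G : Type*} [Group G] {A H K L : Subgroup G} [A.Normal]
    (h₁ : ⁅H, L⁆ ≤ A) (h₂ : ⁅K, L⁆ ≤ A) : ⁅H ⊔ K, L⁆ ≤ A := by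
  rw [commutator_le_iff_map_le_centralizer] at *
  exact sup_le h₁ h₂

/-- A finite solvable group has normal subgroups `A ≤ F` with `A` central in `F`, `F / A` abelian,
and `F` large enough to contain everything in the centralizer of `A` acting trivially on `F / A`. -/
theorem exists_abelian_normal_and_class_two {G : Type*} [Group G] [Finite G] [Group.IsSolvable G] :
    ∃ A F : Subgroup G, A.Normal ∧ F.Normal ∧ A ≤ F ∧ ⁅F, A⁆ = ⊥ ∧ ⁅F, F⁆ ≤ A ∧
      F ⊓ Subgroup.centralizer F ≤ A ∧
      ∀ c : G, c ∈ Subgroup.centralizer (A : Set G) → (∀ f ∈ F, c * f * c⁻¹ * f⁻¹ ∈ A) → c ∈ F := by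
  obtain ⟨A, ⟨hAn, hAc⟩, hAmax⟩ :=
    (Set.toFinite {A : Subgroup G | A.Normal ∧ ⁅A, A⁆ = ⊥}).exists_maximal
    ⟨⊥, inferInstance, by simp⟩
  obtain ⟨F, ⟨hFn, hAF, hFA, hFF⟩, hFmax⟩ := (Set.toFinite {F : Subgroup G | F.Normal ∧ A ≤ F ∧
    ⁅F, A⁆ = ⊥ ∧ ⁅F, F⁆ ≤ A}).exists_maximal ⟨A, hAn, le_rfl, hAc, by simp [hAc]⟩
  have hZ : F ⊓ Subgroup.centralizer F ≤ A := by
    refine hAmax (y := F ⊓ Subgroup.centralizer F) ⟨inferInstance, ?_⟩ (le_inf hAF ?_)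
    · rw [Subgroup.commutator_eq_bot_iff_le_centralizer]
      exact inf_le_right.trans (Subgroup.centralizer_le inf_le_left)
    · rw [← Subgroup.commutator_eq_bot_iff_le_centralizer, Subgroup.commutator_comm, hFA]
  -- Otherwise some normal `E ≤ C(F)`, abelian modulo `A` and not inside `A`, could be adjoined to
  -- `F`. Maximality puts `E` in `F ⊓ C(F) ≤ A`.
  have hD : Subgroup.centralizer (F : Set G) ≤ A := by
    by_contra hD
    obtain ⟨E, hEn, hED, hEA, hEE⟩ :=
      exists_normal_commutator_le A (Subgroup.centralizer (F : Set G)) hD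
    have hEF : ⁅E, F⁆ = ⊥ := by
      rwa [Subgroup.commutator_eq_bot_iff_le_centralizer]
    have hFE : ⁅F, E⁆ = ⊥ := by rw [Subgroup.commutator_comm, hEF]
    have hle : F ⊔ E ≤ F := by
      refine hFmax (y := F ⊔ E) ⟨inferInstance, hAF.trans le_sup_left, ?_, ?_⟩ le_sup_left
      · rw [eq_bot_iff]
        refine sup_commutator_le hFA.le ((Subgroup.commutator_mono le_rfl hAF).trans hEF.le)
      · refine sup_commutator_le ?_ ?_ <;> rw [Subgroup.commutator_comm] <;>
          refine sup_commutator_le ?_ ?_ <;> simp [*]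
    exact hEA ((le_inf (le_sup_right.trans hle) hED).trans hZ)
  refine ⟨A, F, hAn, hFn, hAF, hFA, hFF, hZ, ?_⟩
  let K : Subgroup G := Subgroup.centralizer (A : Set G) ⊓
    (Subgroup.centralizer (F.map (QuotientGroup.mk' A) : Set (G ⧸ A))).comap (QuotientGroup.mk' A)
  have hKF : ⁅K, F⁆ ≤ A := (commutator_le_iff_map_le_centralizer A K F).2 inf_le_right
  have hKA : ⁅K, A⁆ = ⊥ := Subgroup.commutator_eq_bot_iff_le_centralizer.2 inf_le_left
  have hAK : ⁅A, K⁆ = ⊥ := by rw [Subgroup.commutator_comm, hKA]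
  have hmapn : (F.map (QuotientGroup.mk' A)).Normal :=
    hFn.map _ (QuotientGroup.mk'_surjective A)
  have hKn : K.Normal := inferInstance
  -- By the three subgroups lemma `⁅K, K⁆` centralizes `F`, so it lies in `A`. Thus `K` competes
  -- with `F` and maximality gives `K ≤ F`.
  have hKKF : ⁅⁅K, K⁆, F⁆ = ⊥ := by
    refine Subgroup.commutator_commutator_eq_bot_of_rotate ?_ ?_
    · exact eq_bot_iff.2 ((Subgroup.commutator_mono hKF le_rfl).trans hAK.le)
    · rw [Subgroup.commutator_comm F K]
      exact eq_bot_iff.2 ((Subgroup.commutator_mono hKF le_rfl).trans hAK.le)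
  have hFK : F ≤ K := le_inf (Subgroup.commutator_eq_bot_iff_le_centralizer.1 hFA)
    ((commutator_le_iff_map_le_centralizer A F F).1 hFF)
  have hKF' : K ≤ F := hFmax (y := K) ⟨hKn, hAF.trans hFK, hKA,
    (Subgroup.commutator_eq_bot_iff_le_centralizer.1 hKKF).trans hD⟩ hFK
  intro c hc hcF
  refine hKF' (Subgroup.mem_inf.2 ⟨hc, ?_⟩)
  rw [Subgroup.mem_comap, Subgroup.mem_centralizer_iff]
  rintro _ ⟨f, hf, rfl⟩
  have h := hcF f hf
  rw [← QuotientGroup.eq_one_iff, ← QuotientGroup.mk'_apply, map_mul, map_mul, map_mul, map_inv,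
    map_inv, mul_inv_eq_one, mul_inv_eq_iff_eq_mul] at h
  exact h.symm

/-! ### Operators commuting up to scalars -/

open Module

/-- The subgroup of the elements of `F` whose operators commute with all operators of `F`. -/
def operatorCenter {F M : Type*} [Group F] [Monoid M] (T : F →* M) : Subgroup F where
  carrier := {f | ∀ g, Commute (T f) (T g)}
  one_mem' g := by simp
  mul_mem' ha hb g := by
    rw [map_mul]
    exact (ha g).mul_left (hb g)
  inv_mem' {a} ha g := by
    have h : T a⁻¹ * (T a * T g) * T a⁻¹ = T a⁻¹ * (T g * T a) * T a⁻¹ := by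
      rw [(ha g).eq]
    simp only [← map_mul] at h
    change T a⁻¹ * T g = T g * T a⁻¹
    rw [← map_mul, ← map_mul]
    simpa [mul_assoc] using h.symm

instance {F M : Type*} [Group F] [Monoid M] (T : F →* M) : (operatorCenter T).Normal where
  conj_mem f hf h g := by
    have h1 : T h⁻¹ * T h = 1 := by rw [← map_mul]; simp
    have h2 : T (h * f * h⁻¹) = T f := by
      rw [map_mul, map_mul, ← (hf h).eq, mul_assoc, ← map_mul]
      simp
    rw [h2]
    exact hf g

/-- If the operators of `F` commute up to scalars, representatives of the cosets of the subgroup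
of elements acting centrally are linearly independent. -/
theorem index_operatorCenter_le {k F U : Type*} [Field k] [Group F] [Finite F] [AddCommGroup U]
    [Module k U] [FiniteDimensional k U] [Nontrivial U] (T : F →* End k U)
    (hT : ∀ f g, ∃ c : k, T g * T f = c • (T f * T g)) :
    (operatorCenter T).index ≤ finrank k U ^ 2 := by
  classical
  have hTinv : ∀ f, T f * T f⁻¹ = 1 := fun f => by rw [← map_mul]; simp
  have hTne : ∀ f, T f ≠ 0 := fun f h => one_ne_zero (α := End k U) (by
    rw [← hTinv f, h, zero_mul])
  have huniq : ∀ f {a b : k}, a • T f = b • T f → a = b := fun f a b h =>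
    smul_left_injective k (hTne f) h
  choose c hc using hT
  have hone : ∀ f, c f 1 = 1 := fun f => by
    have h := hc f 1
    rw [map_one, one_mul, mul_one] at h
    exact (huniq f (by rw [← h, one_smul])).symm
  have hmul : ∀ f g h, c f (g * h) = c f g * c f h := fun f g h => by
    refine huniq (f * (g * h)) ?_
    rw [map_mul T f, ← hc, map_mul, mul_assoc, hc f h, mul_smul_comm, ← mul_assoc, hc f g,
      smul_mul_assoc, smul_smul, mul_assoc, mul_comm]
  let χ : F → (F →* k) := fun f => { toFun := c f, map_one' := hone f, map_mul' := hmul f }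
  have hχ : ∀ f f', χ f = χ f' → f⁻¹ * f' ∈ operatorCenter T := by
    intro f f' h g
    have h1 : c f g = c f' g := DFunLike.congr_fun h g
    have h2 : c f g ≠ 0 := fun h0 => hTne (g * f) (by rw [map_mul, hc, h0, zero_smul])
    refine Commute.symm ?_
    change T g * T (f⁻¹ * f') = T (f⁻¹ * f') * T g
    have h3 : T f * (T g * T (f⁻¹ * f')) = T f * (T (f⁻¹ * f') * T g) := by
      refine smul_right_injective (End k U) h2 ?_
      change c f g • _ = c f g • _
      rw [← mul_assoc, ← smul_mul_assoc, ← hc f g, mul_assoc, ← map_mul T f, mul_inv_cancel_left,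
        hc f' g, ← h1, ← mul_assoc (T f), ← map_mul T f, mul_inv_cancel_left]
    have hinv : T f⁻¹ * T f = 1 := by rw [← map_mul]; simp
    have h4 := congrArg (T f⁻¹ * ·) h3
    simpa only [← mul_assoc, hinv, one_mul] using h4
  have := Fintype.ofFinite (F ⧸ operatorCenter T)
  have hχinj : Function.Injective fun q : F ⧸ operatorCenter T => χ q.out := by
    intro q r h
    rw [← Quotient.out_eq' q, ← Quotient.out_eq' r]
    exact QuotientGroup.eq.2 (hχ _ _ h)
  have hli := (linearIndependent_monoidHom F k).comp _ hχinj
  have hli' : LinearIndependent k fun q : F ⧸ operatorCenter T => T q.out := by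
    rw [Fintype.linearIndependent_iff] at hli ⊢
    intro a ha q
    -- Conjugating the relation by `T g` multiplies each term by its character value at `g`.
    -- Applying `φ` gives a relation between distinct characters, to which Dedekind independence
    -- applies.
    have key : ∀ φ : Dual k (End k U), a q * φ (T q.out) = 0 := by
      intro φ
      refine hli (fun q => a q * φ (T q.out)) ?_ q
      ext g
      have h1 : ∑ q, (a q * c q.out g) • T q.out = 0 := by
        have h2 := congrArg (fun x => T g * x * T g⁻¹) ha
        simp only [Finset.mul_sum, Finset.sum_mul, mul_zero, zero_mul] at h2
        rw [← h2]
        refine Finset.sum_congr rfl fun q _ => ?_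
        rw [mul_smul_comm, hc, smul_mul_assoc, smul_mul_assoc, mul_assoc, hTinv, mul_one, smul_smul]
      have h3 := congrArg φ h1
      rw [map_sum, map_zero] at h3
      simp only [Function.comp_apply, Finset.sum_apply, Pi.smul_apply, Pi.zero_apply]
      rw [← h3]
      refine Finset.sum_congr rfl fun q _ => ?_
      rw [map_smul, smul_eq_mul, smul_eq_mul]
      change a q * φ (T q.out) * c q.out g = _
      ring
    have : a q • T q.out = 0 := by
      rw [← forall_dual_apply_eq_zero_iff k]
      intro φ
      rw [map_smul, smul_eq_mul, key]
    exact (smul_eq_zero.1 this).resolve_right (hTne _)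
  have := hli'.fintype_card_le_finrank
  rwa [finrank_linearMap, ← Nat.card_eq_fintype_card, ← Subgroup.index_eq_card, ← sq] at this

theorem sum_finrank_le_of_iSupIndep {k W ι : Type*} [Field k] [AddCommGroup W] [Module k W]
    [FiniteDimensional k W] [Fintype ι] {p : ι → Submodule k W} (hp : iSupIndep p) :
    ∑ i, finrank k (p i) ≤ finrank k W := by
  classical
  rw [← finrank_directSum]
  exact LinearMap.finrank_le_finrank_of_injective (f := DirectSum.coeLinearMap p)
    hp.dfinsupp_lsum_injective

/-- The common kernel of the actions on the quotients `F ⧸ Z i` lies in `K`, so the automorphism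
bounds multiply. -/
theorem index_iInf_ker_le_of_invariant {Γ F ι : Type*} [Group Γ] [Finite Γ] [Group F] [Finite F]
    [Fintype ι] (θ : Γ →* MulAut F) (Z : ι → Subgroup F) [∀ i, (Z i).Normal]
    (hZ : ∀ i γ, ∀ f ∈ Z i, θ γ f ∈ Z i) (K : Subgroup Γ)
    (hK : ∀ γ, (∀ i f, θ γ f * f⁻¹ ∈ Z i) → γ ∈ K) :
    K.index ≤ ∏ i, autBound (Z i).index := by
  have hmap : ∀ i γ, (Z i).map ((θ γ : MulAut F) : F →* F) = Z i := by
    intro i γ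
    refine le_antisymm (Subgroup.map_le_iff_le_comap.2 fun f hf => hZ i γ f hf) fun f hf => ?_
    refine ⟨θ γ⁻¹ f, hZ i _ f hf, ?_⟩
    change θ γ (θ γ⁻¹ f) = f
    rw [map_inv]
    exact MulAut.apply_inv_self _ _ _
  let Θ : ∀ i, Γ →* MulAut (F ⧸ Z i) := fun i =>
    { toFun := fun γ => QuotientGroup.congr (Z i) (Z i) (θ γ) (hmap i γ)
      map_one' := by
        ext q
        obtain ⟨f, rfl⟩ := QuotientGroup.mk_surjective q
        simp
      map_mul' := fun a b => by
        ext q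
        obtain ⟨f, rfl⟩ := QuotientGroup.mk_surjective q
        simp }
  have hle : ⨅ i, (Θ i).ker ≤ K := by
    intro γ hγ
    refine hK γ fun i f => ?_
    have h1 : Θ i γ = 1 := (Subgroup.mem_iInf.1 hγ) i
    have h2 : ((θ γ f : F) : F ⧸ Z i) = (f : F ⧸ Z i) :=
      congrArg (fun σ : MulAut (F ⧸ Z i) => σ (f : F ⧸ Z i)) h1
    have h3 := QuotientGroup.eq.1 h2.symm
    have h4 := (inferInstance : (Z i).Normal).conj_mem _ h3 f
    simpa using h4
  calc K.index ≤ (⨅ i, (Θ i).ker).index := Subgroup.index_antitone hle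
    _ ≤ ∏ i, (Θ i).ker.index := Subgroup.index_iInf_le _
    _ ≤ ∏ i, autBound (Z i).index := by
        refine Finset.prod_le_prod' fun i _ => ?_
        have : Finite (MulAut (F ⧸ Z i)) := Finite.of_injective
          (fun γ : MulAut (F ⧸ Z i) => (γ : (F ⧸ Z i) → (F ⧸ Z i))) DFunLike.coe_injective
        rw [Subgroup.index_ker, Subgroup.index_eq_card]
        exact (Subgroup.card_le_card_group _).trans (card_mulAut_le _)

/-! ### Weight spaces of an abelian normal subgroup -/

section Weights

variable {G k W : Type*} [Group G] [Field k] [AddCommGroup W] [Module k W]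

/-- The simultaneous eigenspace of a subgroup `A` for the family of eigenvalues `l`. -/
def weightSpace (ρ : G →* End k W) (A : Subgroup G) (l : A → k) : Submodule k W :=
  ⨅ a : A, (ρ a).eigenspace (l a)

theorem mem_weightSpace {ρ : G →* End k W} {A : Subgroup G} {l : A → k} {w : W} :
    w ∈ weightSpace ρ A l ↔ ∀ a : A, ρ a w = l a • w := by
  simp [weightSpace, Submodule.mem_iInf]

/-- The weights of a subgroup `A`: the families of eigenvalues with nonzero eigenspace. -/
abbrev Weight (ρ : G →* End k W) (A : Subgroup G) : Type _ :=
  {l : A → k // weightSpace ρ A l ≠ ⊥}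

theorem map_inv_mul_self (ρ : G →* End k W) (g : G) (w : W) : ρ g⁻¹ (ρ g w) = w := by
  rw [← End.mul_apply, ← map_mul, inv_mul_cancel, map_one, End.one_apply]

theorem map_mem_weightSpace (ρ : G →* End k W) (A : Subgroup G) [A.Normal] (l : A → k) (g : G)
    {w : W} (hw : w ∈ weightSpace ρ A l) :
    ρ g w ∈ weightSpace ρ A fun a => l (MulAut.conjNormal g⁻¹ a) := by
  rw [mem_weightSpace] at hw ⊢
  intro a
  have h1 : (a : G) * g = g * (MulAut.conjNormal g⁻¹ a : A) := by simp [mul_assoc]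
  rw [← End.mul_apply, ← map_mul, h1, map_mul, End.mul_apply, hw, map_smul]

theorem finrank_weightSpace_conj [FiniteDimensional k W] (ρ : G →* End k W) (A : Subgroup G)
    [A.Normal] (l : A → k) (g : G) :
    finrank k (weightSpace ρ A fun a => l (MulAut.conjNormal g⁻¹ a)) =
      finrank k (weightSpace ρ A l) := by
  have key : ∀ (l : A → k) (g : G), finrank k (weightSpace ρ A l) ≤
      finrank k (weightSpace ρ A fun a => l (MulAut.conjNormal g⁻¹ a)) := by
    intro l g
    refine LinearMap.finrank_le_finrank_of_injective
      (f := (ρ g).restrict fun w hw => map_mem_weightSpace ρ A l g hw) ?_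
    intro x y h
    have h' : ρ g x = ρ g y := congrArg Subtype.val h
    ext
    rw [← map_inv_mul_self ρ g x, h', map_inv_mul_self]
  refine le_antisymm ?_ (key l g)
  have h := key (fun a => l (MulAut.conjNormal g⁻¹ a)) g⁻¹
  have h' : (fun a : A => l (MulAut.conjNormal g⁻¹ (MulAut.conjNormal g⁻¹⁻¹ a))) = l :=
    funext fun a => congrArg l (by
      rw [← MulAut.mul_apply, ← map_mul, mul_inv_cancel, map_one, MulAut.one_apply])
  rwa [h'] at h

theorem weightSpace_conj_ne_bot [FiniteDimensional k W] (ρ : G →* End k W) (A : Subgroup G)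
    [A.Normal] (l : A → k) (g : G) (hl : weightSpace ρ A l ≠ ⊥) :
    (weightSpace ρ A fun a => l (MulAut.conjNormal g⁻¹ a)) ≠ ⊥ := by
  rw [Ne, ← Submodule.finrank_eq_zero] at hl ⊢
  rwa [finrank_weightSpace_conj]

/-- The permutation of the weights of a normal subgroup induced by conjugation. -/
def weightPermHom [FiniteDimensional k W] (ρ : G →* End k W) (A : Subgroup G) [A.Normal] :
    G →* Equiv.Perm (Weight ρ A) where
  toFun g :=
    { toFun := fun l => ⟨fun a => l.1 (MulAut.conjNormal g⁻¹ a),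
        weightSpace_conj_ne_bot ρ A l.1 g l.2⟩
      invFun := fun l => ⟨fun a => l.1 (MulAut.conjNormal g a), by
        simpa using weightSpace_conj_ne_bot ρ A l.1 g⁻¹ l.2⟩
      left_inv := fun l => by ext a; simp
      right_inv := fun l => by ext a; simp }
  map_one' := by ext l a; simp
  map_mul' g h := by ext l a; simp

theorem iSupIndep_weightSpace (ρ : G →* End k W) (A : Subgroup G) (hA : ⁅A, A⁆ = ⊥) :
    iSupIndep fun l : A → k => weightSpace ρ A l := by
  refine (End.independent_iInf_maxGenEigenspace_of_forall_mapsTo (fun a : A => ρ a) ?_).mono ?_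
  · intro a b μ
    refine End.mapsTo_maxGenEigenspace_of_comm ?_ μ
    have := Subgroup.commutator_eq_bot_iff_le_centralizer.1 hA a.2 b b.2
    change ρ b * ρ a = ρ a * ρ b
    rw [← map_mul, ← map_mul, this]
  · intro l
    exact iInf_mono fun a => (End.genEigenspace (ρ a) (l a)).monotone le_top

theorem iSup_weightSpace_eq_top [IsAlgClosed k] [FiniteDimensional k W] [Finite G]
    (hG : (Nat.card G : k) ≠ 0) (ρ : G →* End k W) (A : Subgroup G) (hA : ⁅A, A⁆ = ⊥) :
    ⨆ l : A → k, weightSpace ρ A l = ⊤ := by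
  -- Each operator is a root of `X^|G| - 1`, which is separable since `|G|` is nonzero in `k`.
  have hss : ∀ g, (ρ g).IsSemisimple := by
    intro g
    refine End.isSemisimple_of_squarefree_aeval_eq_zero
      (Polynomial.X_pow_sub_one_separable_iff.2 hG).squarefree ?_
    simp only [map_sub, map_pow, Polynomial.aeval_X, map_one]
    rw [← map_pow, pow_card_eq_one', map_one, sub_self]
  have h := End.iSup_iInf_maxGenEigenspace_eq_top_of_iSup_maxGenEigenspace_eq_top_of_commute
    (fun a : A => ρ a) (fun a b _ => by
      have := Subgroup.commutator_eq_bot_iff_le_centralizer.1 hA a.2 b b.2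
      change ρ a * ρ b = ρ b * ρ a
      rw [← map_mul, ← map_mul, this]) fun a => End.iSup_maxGenEigenspace_eq_top _
  rw [← h]
  refine iSup_congr fun l => iInf_congr fun a => ?_
  exact ((hss a).isFinitelySemisimple.maxGenEigenspace_eq_eigenspace _).symm

theorem eq_of_forall_weight [IsAlgClosed k] [FiniteDimensional k W] [Finite G]
    (hG : (Nat.card G : k) ≠ 0) (ρ : G →* End k W) (A : Subgroup G) (hA : ⁅A, A⁆ = ⊥)
    {f f' : End k W} (h : ∀ l : Weight ρ A, ∀ w ∈ weightSpace ρ A l.1, f w = f' w) : f = f' := by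
  have htop : (⊤ : Submodule k W) ≤ LinearMap.eqLocus f f' := by
    rw [← iSup_weightSpace_eq_top hG ρ A hA]
    refine iSup_le fun l => ?_
    by_cases hl : weightSpace ρ A l = ⊥
    · rw [hl]
      exact bot_le
    · exact fun w hw => h ⟨l, hl⟩ w hw
  ext w
  exact htop (Submodule.mem_top (x := w))

/-- If `g` fixes every weight, `a` and its conjugate act by the same scalar on each weight space.
These span, so faithfulness makes them equal. -/
theorem ker_weightPermHom_le [IsAlgClosed k] [FiniteDimensional k W] [Finite G]
    (hG : (Nat.card G : k) ≠ 0) (ρ : G →* End k W) (hρ : Function.Injective ρ) (A : Subgroup G)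
    [A.Normal] (hA : ⁅A, A⁆ = ⊥) :
    (weightPermHom ρ A).ker ≤ Subgroup.centralizer A := by
  intro g hg a ha
  have h1 : ρ (MulAut.conjNormal g⁻¹ (⟨a, ha⟩ : A) : A) = ρ a := by
    refine eq_of_forall_weight hG ρ A hA fun l w hw => ?_
    have h2 : l.1 (MulAut.conjNormal g⁻¹ (⟨a, ha⟩ : A)) = l.1 ⟨a, ha⟩ :=
      congrArg (fun σ : Equiv.Perm (Weight ρ A) => (σ l).1 ⟨a, ha⟩) (MonoidHom.mem_ker.1 hg)
    rw [mem_weightSpace.1 hw, h2]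
    exact (mem_weightSpace.1 hw ⟨a, ha⟩).symm
  have h3 := hρ h1
  simp only [MulAut.conjNormal_apply, inv_inv] at h3
  rwa [mul_assoc, inv_mul_eq_iff_eq_mul] at h3

theorem finite_weight [FiniteDimensional k W] (ρ : G →* End k W) (A : Subgroup G)
    (hA : ⁅A, A⁆ = ⊥) : Finite (Weight ρ A) :=
  (WellFoundedGT.finite_ne_bot_of_iSupIndep (iSupIndep_weightSpace ρ A hA)).to_subtype

/-- The action of the centralizer of `A` on a weight space of `A`. -/
def weightRep (ρ : G →* End k W) (A : Subgroup G) (l : A → k) :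
    Subgroup.centralizer (A : Set G) →* End k (weightSpace ρ A l) where
  toFun c := (ρ c).restrict (p := weightSpace ρ A l) (q := weightSpace ρ A l) fun w hw => by
    rw [mem_weightSpace] at hw ⊢
    intro a
    rw [← End.mul_apply, ← map_mul, c.2 a a.2, map_mul, End.mul_apply, hw, map_smul]
  map_one' := by ext w; simp
  map_mul' a b := by ext w; simp

end Weights

/-! ### Index of an abelian subgroup in a solvable linear group -/

/-- The bound for the contribution of a weight space of dimension `e` to the index of an abelian
normal subgroup of a solvable linear group. -/
def weightBound (e : ℕ) : ℕ :=
  e ^ 2 * autBound (e ^ 2)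

/-- The factor `e^2` of `weightBound` comes from `F / A`, and `autBound (e^2)` from `C(A) / F`
acting on the quotients of `F` by its centrally acting elements. -/
theorem card_centralizer_le {G k W : Type*} [Group G] [Field k] [AddCommGroup W] [Module k W]
    [IsAlgClosed k] [FiniteDimensional k W] [Finite G]
    (hG : (Nat.card G : k) ≠ 0) (ρ : G →* End k W) (hρ : Function.Injective ρ)
    (A F : Subgroup G) [F.Normal] [Fintype (Weight ρ A)]
    (hA : ⁅A, A⁆ = ⊥) (hFA : ⁅F, A⁆ = ⊥) (hFF : ⁅F, F⁆ ≤ A) (hZ : F ⊓ Subgroup.centralizer F ≤ A)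
    (hF : ∀ c : G, c ∈ Subgroup.centralizer (A : Set G) →
      (∀ f ∈ F, c * f * c⁻¹ * f⁻¹ ∈ A) → c ∈ F) :
    Nat.card (Subgroup.centralizer (A : Set G)) ≤
      Nat.card A * ∏ l : Weight ρ A, weightBound (finrank k (weightSpace ρ A l.1)) := by
  set C := Subgroup.centralizer (A : Set G) with hC
  have hFC : F ≤ C := Subgroup.commutator_eq_bot_iff_le_centralizer.1 hFA
  let F' : Subgroup C := F.subgroupOf C
  let T : ∀ l : Weight ρ A, F' →* End k (weightSpace ρ A l.1) := fun l =>
    (weightRep ρ A l.1).comp F'.subtype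
  let Z : Weight ρ A → Subgroup F' := fun l => operatorCenter (T l)
  -- Commutators of `F` lie in `A`, which acts on a weight space by scalars.
  have hTc : ∀ (l : Weight ρ A) (f g : F'), ∃ c : k, T l g * T l f = c • (T l f * T l g) := by
    intro l f g
    have ha : g.1.1 * f.1.1 * g.1.1⁻¹ * f.1.1⁻¹ ∈ A :=
      hFF (Subgroup.commutator_mem_commutator g.2 f.2)
    refine ⟨l.1 ⟨_, ha⟩, ?_⟩
    ext w
    have h1 : (((T l f * T l g) w : weightSpace ρ A l.1) : W) ∈ weightSpace ρ A l.1 :=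
      ((T l f * T l g) w).2
    have h2 := mem_weightSpace.1 h1 ⟨_, ha⟩
    rw [LinearMap.smul_apply, Submodule.coe_smul, ← h2]
    change ρ g.1.1 (ρ f.1.1 w) = ρ _ (ρ f.1.1 (ρ g.1.1 w))
    simp only [← End.mul_apply, ← map_mul]
    congr 2
    group
  have hidx : ∀ l, (Z l).index ≤ finrank k (weightSpace ρ A l.1) ^ 2 := by
    intro l
    have : Nontrivial (weightSpace ρ A l.1) := Submodule.nontrivial_iff_ne_bot.2 l.2
    exact index_operatorCenter_le (T l) (hTc l)
  -- Acting centrally on every weight space means centralizing `F`, by faithfulness.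
  have hZA : ∀ f : F', (∀ l, f ∈ Z l) → f.1.1 ∈ A := by
    intro f hf
    refine hZ ⟨f.2, fun g hg => ?_⟩
    refine hρ (eq_of_forall_weight hG ρ A hA fun l w hw => ?_)
    have h1 := hf l ⟨⟨g, hFC hg⟩, hg⟩
    have h2 := congrArg (fun S : End k (weightSpace ρ A l.1) => (S ⟨w, hw⟩ : W)) h1.eq
    rw [map_mul, map_mul]
    exact h2.symm
  have hcardF : Nat.card F' ≤
      Nat.card A * ∏ l : Weight ρ A, finrank k (weightSpace ρ A l.1) ^ 2 := by
    rw [← Subgroup.card_mul_index (⨅ l, Z l)]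
    refine Nat.mul_le_mul ?_ ((Subgroup.index_iInf_le _).trans
      (Finset.prod_le_prod' fun l _ => hidx l))
    refine Nat.card_le_card_of_injective
      (fun f : (⨅ l, Z l : Subgroup F') => (⟨f.1.1.1, hZA f.1 (Subgroup.mem_iInf.1 f.2)⟩ : A)) ?_
    intro f g h
    have : f.1.1.1 = g.1.1.1 := congrArg (Subtype.val (p := (· ∈ A))) h
    exact Subtype.ext (Subtype.ext (Subtype.ext this))
  have hindexF : F'.index ≤ ∏ l, autBound (Z l).index := by
    refine index_iInf_ker_le_of_invariant (MulAut.conjNormal (H := F')) Z ?_ F' ?_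
    · intro l c f hf g
      have hconj : ∀ x : F', T l (MulAut.conjNormal c x) =
          weightRep ρ A l.1 c * T l x * weightRep ρ A l.1 c⁻¹ := by
        intro x
        change weightRep ρ A l.1 (MulAut.conjNormal c x : F') = _ * weightRep ρ A l.1 x * _
        rw [MulAut.conjNormal_apply, map_mul, map_mul]
      obtain ⟨g, rfl⟩ := (MulAut.conjNormal (H := F') c).surjective g
      change _ * _ = _ * _
      rw [← map_mul, ← map_mul, ← map_mul, ← map_mul, hconj, hconj, map_mul, map_mul, (hf g).eq]
    · intro c hc
      refine hF c c.2 fun f hf => ?_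
      exact hZA _ fun l => hc l ⟨⟨f, hFC hf⟩, hf⟩
  rw [← Subgroup.card_mul_index F']
  calc Nat.card F' * F'.index
      ≤ (Nat.card A * ∏ l : Weight ρ A, finrank k (weightSpace ρ A l.1) ^ 2) *
        ∏ l : Weight ρ A, autBound (finrank k (weightSpace ρ A l.1) ^ 2) :=
        Nat.mul_le_mul hcardF (hindexF.trans
          (Finset.prod_le_prod' fun l _ => autBound_mono (hidx l)))
    _ = _ := by
        rw [mul_assoc, ← Finset.prod_mul_distrib]
        rfl

/-- A finite solvable linear group over an algebraically closed field, of order prime to the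
characteristic, has an abelian subgroup whose index is bounded in terms of the dimensions of its
weight spaces. -/
theorem exists_abelian_card_le {G k W : Type*} [Group G] [Field k] [AddCommGroup W] [Module k W]
    [IsAlgClosed k] [FiniteDimensional k W] [Finite G] [Group.IsSolvable G]
    (hG : (Nat.card G : k) ≠ 0) (ρ : G →* End k W) (hρ : Function.Injective ρ) :
    ∃ (A : Subgroup G) (_ : Fintype (Weight ρ A)) (s : ℕ), ⁅A, A⁆ = ⊥ ∧
      s ≤ 3 ^ (Nat.card (Weight ρ A) - 1) ∧
      ((∃ l l' : Weight ρ A, finrank k (weightSpace ρ A l.1) ≠ finrank k (weightSpace ρ A l'.1)) →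
        s ≤ 3 ^ (Nat.card (Weight ρ A) - 2)) ∧
      Nat.card G ≤
        Nat.card A * (s * ∏ l : Weight ρ A, weightBound (finrank k (weightSpace ρ A l.1))) := by
  obtain ⟨A, F, hAn, hFn, hAF, hFA, hFF, hZ, hF⟩ := exists_abelian_normal_and_class_two (G := G)
  have hA : ⁅A, A⁆ = ⊥ := eq_bot_iff.2 ((Subgroup.commutator_mono hAF le_rfl).trans hFA.le)
  have := finite_weight ρ A hA
  have inst : Fintype (Weight ρ A) := Fintype.ofFinite _
  refine ⟨A, inst, (weightPermHom ρ A).ker.index, hA, index_ker_le_three_pow _, ?_, ?_⟩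
  · intro h
    exact index_ker_le_three_pow_of_ne (weightPermHom ρ A)
      (fun l => finrank k (weightSpace ρ A l.1))
      (fun g l => finrank_weightSpace_conj ρ A l.1 g) h
  · have h1 := card_centralizer_le hG ρ hρ A F hA hFA hFF hZ hF
    have h2 := Subgroup.index_antitone (ker_weightPermHom_le hG ρ hρ A hA)
    rw [← Subgroup.card_mul_index (Subgroup.centralizer (A : Set G))]
    calc _ ≤ _ := Nat.mul_le_mul h1 h2
      _ = _ := by ring

/-! ### Numerical estimates -/

theorem weightBound_one : weightBound 1 = 1 := by decide +kernel

/-- The tight case is `e = 4`, where `weightBound 4 = 322560` and `84^4 / 322560` is just above 154.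
Here `153 = 3 * 51`. -/
theorem mul_weightBound_le (e : ℕ) (he : 2 ≤ e) : 153 * weightBound e ≤ 84 ^ e := by
  by_cases h : e < 32
  · have : ∀ e < 32, 2 ≤ e → 153 * weightBound e ≤ 84 ^ e := by
      unfold weightBound autBound
      decide +kernel
    exact this e h he
  · have he0 : e ≠ 0 := by omega
    set t := Nat.log 2 e with ht
    have ht5 : 5 ≤ t := (Nat.le_log_iff_pow_le (by norm_num) he0).2 (by omega)
    have h1 : 2 ^ t ≤ e := Nat.pow_log_le_self 2 he0
    have h2 : e < 2 ^ (t + 1) := Nat.lt_pow_succ_log_self (by norm_num) e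
    have h3 : e ^ 2 < 2 ^ (2 * t + 2) := by
      calc e ^ 2 < (2 ^ (t + 1)) ^ 2 := Nat.pow_lt_pow_left h2 (by norm_num)
        _ = _ := by rw [← pow_mul]; congr 1; ring
    have h4 : Nat.log 2 (e ^ 2) ≤ 2 * t + 1 := by
      have := Nat.log_lt_of_lt_pow (pow_ne_zero 2 he0) h3
      omega
    have h5 : ∀ s, 5 ≤ s → 8 + (2 * s + 2) * (2 * s + 2) ≤ 6 * 2 ^ s := by
      intro s hs
      induction s, hs using Nat.le_induction with
      | base => norm_num
      | succ s hs ih => rw [pow_succ]; nlinarith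
    have h6 : weightBound e ≤ 2 ^ ((2 * t + 2) * (2 * t + 2)) := by
      calc weightBound e ≤ e ^ 2 * (e ^ 2) ^ (2 * t + 1) :=
            Nat.mul_le_mul_left _ ((autBound_le _).trans
              (Nat.pow_le_pow_right (by positivity) h4))
        _ = (e ^ 2) ^ (2 * t + 2) := by ring
        _ ≤ (2 ^ (2 * t + 2)) ^ (2 * t + 2) := Nat.pow_le_pow_left h3.le _
        _ = _ := by rw [← pow_mul]
    calc 153 * weightBound e ≤ 2 ^ 8 * 2 ^ ((2 * t + 2) * (2 * t + 2)) :=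
          Nat.mul_le_mul (by norm_num) h6
      _ = 2 ^ (8 + (2 * t + 2) * (2 * t + 2)) := by rw [pow_add]
      _ ≤ 2 ^ (6 * e) := Nat.pow_le_pow_right (by norm_num) (by have := h5 t ht5; omega)
      _ = 64 ^ e := by rw [pow_mul]; norm_num
      _ ≤ 84 ^ e := Nat.pow_le_pow_left (by norm_num) _

theorem weightBound_mono {a b : ℕ} (h : a ≤ b) : weightBound a ≤ weightBound b :=
  Nat.mul_le_mul (Nat.pow_le_pow_left h 2) (autBound_mono (Nat.pow_le_pow_left h 2))

theorem weightBound_le_pow (d : ℕ) (hd : 3 ≤ d) : weightBound d ≤ 7056 ^ (d - 2) := by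
  obtain ⟨m, rfl⟩ : ∃ m, d = m + 3 := ⟨d - 3, by omega⟩
  have h := mul_weightBound_le (m + 3) (by omega)
  have h1 : 1 ≤ 84 ^ m := Nat.one_le_pow _ _ (by norm_num)
  have h2 : (7056 : ℕ) ^ (m + 3 - 2) = 7056 * (84 ^ m * 84 ^ m) := by
    rw [← mul_pow, show m + 3 - 2 = m + 1 by omega, pow_succ]; norm_num [mul_comm]
  rw [h2]
  rw [pow_add] at h
  nlinarith

/-- The gain in the estimate `3 * weightGain e * weightBound e ≤ 84 ^ e`. -/
def weightGain (e : ℕ) : ℕ := if e = 1 then 28 else 51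

theorem mul_weightGain_le (e : ℕ) (he : 1 ≤ e) :
    3 * weightGain e * weightBound e ≤ 84 ^ e := by
  unfold weightGain
  split_ifs with h
  · subst h
    rw [weightBound_one]
    norm_num
  · exact mul_weightBound_le e (by omega)

/-- Multiplying the estimates `mul_weightGain_le` bounds `3^n * R * P` by `84^d`, so two factors 84
must be recovered from the gains and from the slack in `s`. -/
theorem mul_prod_weightBound_lt {ι : Type*} [Fintype ι] (e : ι → ℕ) (he : ∀ i, 1 ≤ e i) {d s : ℕ}
    (hd : 3 ≤ d) (hsum : ∑ i, e i ≤ d) (hcard : 2 ≤ Fintype.card ι)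
    (hs : s ≤ 3 ^ (Fintype.card ι - 1))
    (hs' : (∃ i j, e i ≠ e j) → s ≤ 3 ^ (Fintype.card ι - 2)) :
    s * ∏ i, weightBound (e i) < 84 ^ (d - 2) := by
  classical
  set n := Fintype.card ι with hn
  set P := ∏ i, weightBound (e i) with hP
  set R := ∏ i, weightGain (e i) with hR
  have hprod : 3 ^ n * R * P ≤ 84 ^ d := by
    calc 3 ^ n * R * P = ∏ i, (3 * weightGain (e i) * weightBound (e i)) := by
          rw [Finset.prod_mul_distrib, Finset.prod_mul_distrib, Finset.prod_const,
            Finset.card_univ]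
      _ ≤ ∏ i, 84 ^ e i := Finset.prod_le_prod' fun i _ => mul_weightGain_le _ (he i)
      _ = 84 ^ ∑ i, e i := Finset.prod_pow_eq_pow_sum _ _ _
      _ ≤ 84 ^ d := Nat.pow_le_pow_right (by norm_num) hsum
  have hgain : ∀ i, 28 ≤ weightGain (e i) := fun i => by unfold weightGain; split_ifs <;> norm_num
  have hd84 : (84 : ℕ) ^ d = 84 ^ 2 * 84 ^ (d - 2) := by
    rw [← pow_add]; congr 1; omega
  have hpos : 0 < (84 : ℕ) ^ (d - 2) := by positivity
  have key : ∀ c : ℕ, c * s ≤ 3 ^ n → 84 ^ 2 < c * R → s * P < 84 ^ (d - 2) := by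
    intro c h1 h2
    rcases Nat.eq_zero_or_pos (s * P) with h0 | h0
    · rw [h0]
      exact hpos
    · refine lt_of_mul_lt_mul_left (a := 84 ^ 2) ?_ (Nat.zero_le _)
      calc 84 ^ 2 * (s * P) < c * R * (s * P) := Nat.mul_lt_mul_of_pos_right h2 h0
        _ = (c * s) * R * P := by ring
        _ ≤ 3 ^ n * R * P := by gcongr
        _ ≤ 84 ^ d := hprod
        _ = _ := hd84
  by_cases hne : ∃ i j, e i ≠ e j
  · obtain ⟨i, j, hij⟩ := hne
    refine key 9 ?_ ?_
    · calc 9 * s ≤ 3 ^ 2 * 3 ^ (n - 2) := Nat.mul_le_mul (by norm_num) (hs' ⟨i, j, hij⟩)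
        -- With unequal dimensions the gains may be only `28 * 51`. Then `3 * 28 * 51 < 84^2`, but
        -- the second saved factor 3 suffices.
        _ = 3 ^ n := by rw [← pow_add]; congr 1; omega
    · have h1 : weightGain (e i) * weightGain (e j) ≤ R := by
        rw [← Finset.prod_pair (f := fun i => weightGain (e i)) (fun h => hij (congrArg e h))]
        exact Finset.prod_le_prod_of_subset_of_one_le' (Finset.subset_univ _)
          fun x _ _ => le_trans (by norm_num) (hgain x)
      have h2 : 28 * 51 ≤ weightGain (e i) * weightGain (e j) := by
        unfold weightGain
        split_ifs <;> omega
      omega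
  · push Not at hne
    have hs3 : 3 * s ≤ 3 ^ n := by
      calc 3 * s ≤ 3 ^ 1 * 3 ^ (n - 1) := Nat.mul_le_mul (by norm_num) hs
        _ = 3 ^ n := by rw [← pow_add]; congr 1; omega
    obtain ⟨i₀⟩ : Nonempty ι := Fintype.card_pos_iff.1 (by omega)
    have hRn : R = weightGain (e i₀) ^ n := by
      rw [hR, Finset.prod_congr rfl fun i _ => by rw [hne i i₀], Finset.prod_const,
        Finset.card_univ]
    by_cases h1 : e i₀ = 1
    · by_cases hn3 : 3 ≤ n
      · refine key 3 hs3 ?_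
        have : 28 ^ 3 ≤ R := by
          rw [hRn, h1]
          exact Nat.pow_le_pow_right (by norm_num [weightGain]) hn3
        omega
      -- For two one-dimensional weight spaces `3 * 28^2` is too small, but then the product is 1
      -- and `s ≤ 3` directly.
      · have hn2 : n = 2 := by omega
        have hP1 : P = 1 := Finset.prod_eq_one fun i _ => by rw [hne i i₀, h1, weightBound_one]
        rw [hP1, mul_one]
        rw [hn2] at hs
        calc s ≤ 3 := by simpa using hs
          _ < 84 ^ 1 := by norm_num
          _ ≤ 84 ^ (d - 2) := Nat.pow_le_pow_right (by norm_num) (by omega)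
    · refine key 3 hs3 ?_
      have : 51 ^ 2 ≤ R := by
        rw [hRn, weightGain, if_neg h1]
        exact Nat.pow_le_pow_right (by norm_num) hcard
      omega

/-! ### Class numbers and commuting pairs -/

/-- The number of commuting pairs in `G` is `|G| k(G)`, and all pairs from `B` commute. -/
theorem sq_card_le_card_mul_classNumber {G : Type*} [Group G] [Finite G] (B : Subgroup G)
    (hB : ∀ a ∈ B, ∀ b ∈ B, a * b = b * a) :
    Nat.card B ^ 2 ≤ Nat.card G * classNumber G := by
  rw [classNumber, mul_comm, ← card_comm_eq_card_conjClasses_mul_card, sq, ← Nat.card_prod]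
  refine Nat.card_le_card_of_injective
    (fun x : B × B => (⟨(x.1.1, x.2.1), hB _ x.1.2 _ x.2.2⟩ : {p : G × G // Commute p.1 p.2})) ?_
  rintro ⟨a, b⟩ ⟨a', b'⟩ h
  have h' : ((a : G), (b : G)) = ((a' : G), (b' : G)) := congrArg (fun x => x.1) h
  rw [Prod.mk.injEq] at h'
  exact Prod.ext (Subtype.ext h'.1) (Subtype.ext h'.2)

theorem classNumber_le_of_surjective {G H : Type*} [Group G] [Group H] [Finite G] (f : G →* H)
    (hf : Function.Surjective f) : classNumber H ≤ classNumber G := by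
  have : Finite (ConjClasses G) := Quotient.finite _
  refine Nat.card_le_card_of_surjective (ConjClasses.map f) ?_
  intro c
  obtain ⟨h, rfl⟩ := ConjClasses.mk_surjective c
  obtain ⟨g, rfl⟩ := hf h
  exact ⟨ConjClasses.mk g, rfl⟩

theorem card_le_card_mul_classNumber_semidirect {N H : Type*} [CommGroup N] [Group H] [Finite N]
    [Finite H] (φ : H →* MulAut N) :
    Nat.card N ≤ Nat.card H * classNumber (N ⋊[φ] H) := by
  have : Finite (N ⋊[φ] H) := Finite.of_equiv _ SemidirectProduct.equivProd.symm
  have h1 := sq_card_le_card_mul_classNumber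
    (SemidirectProduct.inl : N →* N ⋊[φ] H).range (by
      rintro _ ⟨a, rfl⟩ _ ⟨b, rfl⟩
      rw [← map_mul, ← map_mul, mul_comm])
  have h2 : Nat.card (SemidirectProduct.inl : N →* N ⋊[φ] H).range = Nat.card N :=
    Nat.card_congr (MonoidHom.ofInjective SemidirectProduct.inl_injective).symm.toEquiv
  rw [h2, SemidirectProduct.card, sq, mul_assoc] at h1
  exact Nat.le_of_mul_le_mul_left h1 Nat.card_pos

theorem classNumber_le_semidirect {N H : Type*} [Group N] [Group H] [Finite N] [Finite H]
    (φ : H →* MulAut N) : classNumber H ≤ classNumber (N ⋊[φ] H) := by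
  have : Finite (N ⋊[φ] H) := Finite.of_equiv _ SemidirectProduct.equivProd.symm
  exact classNumber_le_of_surjective SemidirectProduct.rightHom
    SemidirectProduct.rightHom_surjective

/-! ### Passage from the prime field to its closure, and conclusion -/

/-- A finite solvable linear group over the field with `p` elements of order prime to `p` has an
abelian subgroup that either has small index or consists of scalars and has small index. -/
theorem exists_abelian_card_le_zmod {p : ℕ} [Fact p.Prime] {G V : Type*} [Group G] [Finite G]
    [Group.IsSolvable G] [AddCommGroup V] [Module (ZMod p) V] [FiniteDimensional (ZMod p) V]
    (hG : (Nat.card G).Coprime p) (hd : 3 ≤ finrank (ZMod p) V) (ρ : G →* End (ZMod p) V)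
    (hρ : Function.Injective ρ) :
    ∃ (A : Subgroup G) (m : ℕ), (∀ a ∈ A, ∀ b ∈ A, a * b = b * a) ∧
      Nat.card G ≤ Nat.card A * m ∧
      (m < 84 ^ (finrank (ZMod p) V - 2) ∨
        Nat.card A ≤ p ∧ m ≤ 7056 ^ (finrank (ZMod p) V - 2)) := by
  set d := finrank (ZMod p) V with hdd
  let k := AlgebraicClosure (ZMod p)
  let b : Basis (Fin d) (ZMod p) V := finBasis (ZMod p) V
  let M : G →* Matrix (Fin d) (Fin d) (ZMod p) :=
    (LinearMap.toMatrixAlgEquiv b : End (ZMod p) V →* Matrix (Fin d) (Fin d) (ZMod p)).comp ρ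
  let σ : G →* End k (Fin d → k) :=
    ((Matrix.toLinAlgEquiv' : Matrix (Fin d) (Fin d) k ≃ₐ[k] End k (Fin d → k)) :
      Matrix (Fin d) (Fin d) k →* End k (Fin d → k)).comp
      (((algebraMap (ZMod p) k).mapMatrix (m := Fin d)).toMonoidHom.comp M)
  have hM : Function.Injective M := (LinearMap.toMatrixAlgEquiv b).injective.comp hρ
  have hσ : Function.Injective σ :=
    (Matrix.toLinAlgEquiv' (R := k) (n := Fin d)).injective.comp
      ((Matrix.map_injective (algebraMap (ZMod p) k).injective).comp hM)
  have hσM : ∀ g i j, σ g (Pi.single j 1) i = algebraMap (ZMod p) k (M g i j) := by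
    intro g i j
    change Matrix.toLin' ((M g).map (algebraMap (ZMod p) k)) (Pi.single j 1) i = _
    rw [Matrix.toLin'_apply, Matrix.mulVec_single_one]
    rfl
  have hGk : (Nat.card G : k) ≠ 0 := by
    rw [Ne, CharP.cast_eq_zero_iff k p]
    intro h
    have h1 := Nat.Coprime.eq_one_of_dvd (Nat.Coprime.symm hG) h
    exact (Fact.out : p.Prime).one_lt.ne' h1
  obtain ⟨A, inst, s, hA, hs, hs', hcard⟩ := exists_abelian_card_le hGk σ hσ
  have hcomm : ∀ a ∈ A, ∀ b ∈ A, a * b = b * a := fun a ha b hb =>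
    (Subgroup.commutator_eq_bot_iff_le_centralizer.1 hA ha b hb).symm
  refine ⟨A, _, hcomm, hcard, ?_⟩
  have he : ∀ l : Weight σ A, 1 ≤ finrank k (weightSpace σ A l.1) := fun l =>
    Submodule.one_le_finrank_iff.2 l.2
  have hsum : ∑ l : Weight σ A, finrank k (weightSpace σ A l.1) ≤ d := by
    have := sum_finrank_le_of_iSupIndep
      ((iSupIndep_weightSpace σ A hA).comp (f := fun l : Weight σ A => l.1) Subtype.val_injective)
    rwa [finrank_fin_fun] at this
  rw [Nat.card_eq_fintype_card] at hs hs'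
  rcases le_or_gt 2 (Fintype.card (Weight σ A)) with hn | hn
  · exact Or.inl (mul_prod_weightBound_lt _ he hd hsum hn hs hs')
  · right
    have hsub : Subsingleton (Weight σ A) := Fintype.card_le_one_iff_subsingleton.1 (by omega)
    have hs1 : s ≤ 1 := by
      rwa [show Fintype.card (Weight σ A) - 1 = 0 by omega, pow_zero] at hs
    let i₀ : Fin d := ⟨0, by omega⟩
    have hscalar : ∀ a ∈ A, ∃ c : k, σ a = c • 1 := by
      intro a ha
      rcases isEmpty_or_nonempty (Weight σ A) with hE | ⟨⟨l₀⟩⟩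
      -- Without weights any two operators agree, so any scalar would do.
      · exact ⟨0, eq_of_forall_weight hGk σ A hA fun l => hE.elim l⟩
      · refine ⟨l₀.1 ⟨a, ha⟩, eq_of_forall_weight hGk σ A hA fun l w hw => ?_⟩
        rw [Subsingleton.elim l l₀] at hw
        exact mem_weightSpace.1 hw ⟨a, ha⟩
    constructor
    -- The scalar is a diagonal entry of a matrix over `ZMod p`, so it takes at most `p` values.
    · have hinj : Function.Injective fun a : A => M a i₀ i₀ := by
        intro a a' h
        obtain ⟨c, hc⟩ := hscalar a a.2
        obtain ⟨c', hc'⟩ := hscalar a' a'.2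
        have h1 := hσM a i₀ i₀
        have h2 := hσM a' i₀ i₀
        rw [hc] at h1
        rw [hc'] at h2
        simp only [LinearMap.smul_apply, End.one_apply, Pi.smul_apply, Pi.single_eq_same,
          smul_eq_mul, mul_one] at h1 h2
        have h' : M a i₀ i₀ = M a' i₀ i₀ := h
        refine Subtype.ext (hσ ?_)
        rw [hc, hc', h1, h2, h']
      have := Nat.card_le_card_of_injective _ hinj
      rwa [Nat.card_zmod] at this
    · have hP : ∏ l : Weight σ A, weightBound (finrank k (weightSpace σ A l.1)) ≤
          weightBound d := by
        rcases isEmpty_or_nonempty (Weight σ A) with hE | ⟨⟨l₀⟩⟩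
        · rw [Finset.univ_eq_empty, Finset.prod_empty, ← weightBound_one]
          exact weightBound_mono (by omega)
        · rw [Fintype.prod_subsingleton _ l₀]
          refine weightBound_mono ((Finset.single_le_sum (f := fun l : Weight σ A =>
            finrank k (weightSpace σ A l.1)) (fun _ _ => Nat.zero_le _)
            (Finset.mem_univ l₀)).trans hsum)
      calc _ ≤ 1 * weightBound d := Nat.mul_le_mul hs1 hP
        _ = weightBound d := one_mul _
        _ ≤ _ := weightBound_le_pow d hd

/-- Linear endomorphisms as endomorphisms over the prime field. -/
def endToZModEnd {K V : Type*} [Field K] [AddCommGroup V] [Module K V] (p : ℕ)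
    [Module (ZMod p) V] : End K V →* End (ZMod p) V where
  toFun f := (f : V →+ V).toZModLinearMap p
  map_one' := rfl
  map_mul' _ _ := rfl

theorem lt_classNumber_affineSemidirect {K V : Type*} [Field K] [AddCommGroup V] [Module K V]
    [Finite V] (p : ℕ) [Fact p.Prime] [Module (ZMod p) V] (hp : 7200 < p)
    (hV : p ^ 3 ≤ Nat.card V) (H : Subgroup (LinearMap.GeneralLinearGroup K V))
    [Group.IsSolvable H] (hH : (Nat.card H).Coprime p) :
    p < classNumber (AffineSemidirect H) := by
  have hfinH : Finite H := by
    refine Finite.of_injective (fun h : H => ((h.1 : V →ₗ[K] V) : V → V)) fun a b hab => ?_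
    exact Subtype.ext (Units.ext (DFunLike.coe_injective hab))
  have hfd : FiniteDimensional (ZMod p) V := Module.Finite.of_finite
  have hcardV : Nat.card V = p ^ finrank (ZMod p) V := by
    exact (FiniteField.pow_finrank_eq_natCard p V).symm
  have hd : 3 ≤ finrank (ZMod p) V := by
    rw [hcardV] at hV
    exact (Nat.pow_le_pow_iff_right (Fact.out : p.Prime).one_lt).1 hV
  let ρ : H →* End (ZMod p) V :=
    (endToZModEnd p).comp ((Units.coeHom (End K V)).comp H.subtype)
  have hρ : Function.Injective ρ := fun a b hab =>
    Subtype.ext (Units.ext (LinearMap.ext fun v => LinearMap.congr_fun hab v))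
  obtain ⟨A, m, hA, hHA, hm⟩ := exists_abelian_card_le_zmod hH hd ρ hρ
  set d := finrank (ZMod p) V
  set κ := classNumber (AffineSemidirect H) with hκ
  have h1 : p ^ d ≤ Nat.card H * κ := by
    rw [← hcardV]
    exact card_le_card_mul_classNumber_semidirect (N := Multiplicative V) (linearActionHom H)
  have h2 : Nat.card A ^ 2 ≤ Nat.card H * κ :=
    (sq_card_le_card_mul_classNumber A hA).trans
      (Nat.mul_le_mul_left _ (classNumber_le_semidirect (linearActionHom H)))
  have hpd : p ^ d = p ^ 2 * p ^ (d - 2) := by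
    rw [← pow_add]; congr 1; omega
  have hlt : 7056 ^ (d - 2) < p ^ (d - 2) := Nat.pow_lt_pow_left (by omega) (by omega)
  have hp2 : 0 < p ^ 2 := by positivity
  by_contra! hκp
  rcases hm with hm | ⟨hAp, hm⟩
  · have hApos : 0 < Nat.card A ^ 2 := pow_pos Nat.card_pos 2
    -- Multiplying the two lower bounds for `|H| κ` lets the unknown `|A|` cancel.
    have h3 : p ^ d * Nat.card A ^ 2 ≤ p ^ 2 * m ^ 2 * Nat.card A ^ 2 := by
      calc p ^ d * Nat.card A ^ 2 ≤ (Nat.card H * κ) * (Nat.card H * κ) := Nat.mul_le_mul h1 h2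
        _ ≤ (Nat.card A * m * p) * (Nat.card A * m * p) :=
            Nat.mul_le_mul (Nat.mul_le_mul hHA hκp) (Nat.mul_le_mul hHA hκp)
        _ = _ := by ring
    have h4 := Nat.le_of_mul_le_mul_right h3 hApos
    rw [hpd] at h4
    have h5 := Nat.le_of_mul_le_mul_left h4 hp2
    have h6 : m ^ 2 ≤ 7056 ^ (d - 2) := by
      calc m ^ 2 ≤ (84 ^ (d - 2)) ^ 2 := Nat.pow_le_pow_left hm.le 2
        _ = 7056 ^ (d - 2) := by rw [← pow_mul, mul_comm, pow_mul]; norm_num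
    omega
  -- In the scalar case `|A| ≤ p` already makes the bound from `V` sufficient.
  · have h3 : p ^ d ≤ p ^ 2 * m := by
      calc p ^ d ≤ Nat.card H * κ := h1
        _ ≤ (p * m) * p := Nat.mul_le_mul (hHA.trans (Nat.mul_le_mul_right _ hAp)) hκp
        _ = _ := by ring
    rw [hpd] at h3
    have h4 := Nat.le_of_mul_le_mul_left h3 hp2
    omega

theorem mainTheorem7 {K V : Type*} [Field K] [AddCommGroup V] [Module K V] [Finite V]
    (p : ℕ) [CharP K p] (hp : 7200 < p) (hV : p ^ 3 ≤ Nat.card V)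
    (H : Subgroup (LinearMap.GeneralLinearGroup K V)) [Group.IsSolvable H]
    (hH : (Nat.card H).Coprime p) :
    p < classNumber (AffineSemidirect H) := by
  have hprime : Fact p.Prime :=
    ⟨(CharP.char_is_prime_or_zero K p).resolve_right (by omega)⟩
  have hpV : ∀ v : V, p • v = 0 := fun v => by
    rw [← Nat.cast_smul_eq_nsmul K, CharP.cast_eq_zero, zero_smul]
  have : Module (ZMod p) V := AddCommGroup.zmodModule hpV
  exact lt_classNumber_affineSemidirect p hp hV H hH
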